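/- Let $p$ be a prime and let $(V,\pi)$ be a discrete valuation ring of mixed characteristic $(0,p)$ with uniformizer $\pi$ and residue field $k=V/\pi V$, and assume that $V$ is ramified, i.e. $p\in \pi^2V$. Let $n\ge 0$, $S=V[x_1,\dots,x_n]$, $\overline S=S/\pi S$ (a $k$-algebra), and let $k^p=\{c^p : c\in k\}\subseteq k$. (1) There is a $\mathbb Z$-derivation $\frac{\partial}{\partial\pi}\colon S\to\overline S$ with $\frac{\partial(\pi)}{\partial\pi}=1$; it can be chosen so that moreover $\frac{\partial(x_i)}{\partial\pi}=0$ for $i=1,\dots,n$. Let $\frac{\partial}{\partial\pi}\colon S\to\overline S$ be any $\mathbb Z$-derivation with $\frac{\partial(\pi)}{\partial\pi}=1$. Put $\Omega^\pi_{S/\mathbb Z}=\Omega_{\overline S/k^p}\oplus\overline S\,d\pi$, where $\overline S\,d\pi$ is free of rank one on the symbol $d\pi$, and let $$d^\pi_{S/\mathbb Z}\colon S\to\Omega^\pi_{S/\mathbb Z},\qquad s\mapsto d_{\overline S/k^p}(\overline s)+\frac{\partial(s)}{\partial\pi}\,d\pi,$$ where $\overline s$ is the image of $s$ in $\overline S$.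 (2) $d^\pi_{S/\mathbb Z}$ is a $\mathbb Z$-derivation which represents the functor $\operatorname{Der}_{\mathbb Z}(S,-)\colon \overline S\text{-Mod}\to\overline S\text{-Mod}$: for every $\overline S$-module $M$, the natural $\overline S$-linear map $\operatorname{Hom}_{\overline S}(\Omega^\pi_{S/\mathbb Z},M)\to\operatorname{Der}_{\mathbb Z}(S,M)$, $\varphi\mapsto\varphi\circ d^\pi_{S/\mathbb Z}$, is bijective. (3) Let $\overline d_{S/\mathbb Z}\colon S\to\overline\Omega_{S/\mathbb Z}=\Omega_{S/\mathbb Z}/\pi\Omega_{S/\mathbb Z}$ be the universal derivation of $S$ over $\mathbb Z$ followed by the quotient map. There is an isomorphism of $\overline S$-modules $e\colon\overline\Omega_{S/\mathbb Z}\to\Omega^\pi_{S/\mathbb Z}$ with $e\circ\overline d_{S/\mathbb Z}=d^\pi_{S/\mathbb Z}$. In particular $\Omega_{S/\mathbb Z}/\pi\Omega_{S/\mathbb Z}\cong\Omega_{\overline S/k^p}\oplus\overline S\,d\pi$. -/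

import Mathlib

open scoped KaehlerDifferential

universe w u

noncomputable section

/-- The polynomial ring `S = V[x_1, …, x_n]`. -/
abbrev PolyS (V : Type*) [CommRing V] (n : ℕ) : Type _ := MvPolynomial (Fin n) V

/-- The ideal `π S` of `S = V[x_1, …, x_n]`. -/
abbrev idealPi {V : Type*} [CommRing V] (π : V) (n : ℕ) : Ideal (PolyS V n) :=
  Ideal.span {MvPolynomial.C π}

/-- The ring `S̄ = S / π S`. -/
abbrev SBar {V : Type*} [CommRing V] (π : V) (n : ℕ) : Type _ := PolyS V n ⧸ idealPi π n

/-- The residue ring `k = V / π V`. -/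
abbrev ResPi {V : Type*} [CommRing V] (π : V) : Type _ := V ⧸ (Ideal.span {π} : Ideal V)

/-- The structure map `k = V / π V → S / π S = S̄` induced by `V → S`. -/
def resPiToSBar {V : Type*} [CommRing V] (π : V) (n : ℕ) : ResPi π →+* SBar π n :=
  Ideal.quotientMap (idealPi π n) (MvPolynomial.C : V →+* PolyS V n) (by
    rw [Ideal.span_le, Set.singleton_subset_iff]
    exact Ideal.subset_span (Set.mem_singleton _))

instance instAlgebraResPiSBar {V : Type*} [CommRing V] (π : V) (n : ℕ) :
    Algebra (ResPi π) (SBar π n) :=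
  (resPiToSBar π n).toAlgebra

/-- The subring `k^p = {c ^ p | c ∈ k}` of `k = V / π V`. -/
abbrev ResPiPow {V : Type*} [CommRing V] (p : ℕ) [Fact p.Prime] (π : V) [CharP (ResPi π) p] :
    Subring (ResPi π) :=
  (frobenius (ResPi π) p).range

instance instSMulCommClassSBar {V : Type*} [CommRing V] (p : ℕ) [Fact p.Prime] (π : V)
    [CharP (ResPi π) p] (n : ℕ) : SMulCommClass (ResPiPow p π) (PolyS V n) (SBar π n) :=
  ⟨fun c s b => by
    rw [Algebra.smul_def c (s • b), Algebra.smul_def c b, mul_smul_comm]⟩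

/-- The `S`-module structure on `Ω_{S̄/k^p}` through `S → S̄`; a shortcut to the general instance. -/
instance instModuleOmegaSBar {V : Type*} [CommRing V] (p : ℕ) [Fact p.Prime] (π : V)
    [CharP (ResPi π) p] (n : ℕ) : Module (PolyS V n) (Ω[SBar π n⁄ResPiPow p π]) :=
  instModuleKaehlerDifferentialOfSMulCommClass (ResPiPow p π) (SBar π n)

instance instSMulOmegaSBar {V : Type*} [CommRing V] (p : ℕ) [Fact p.Prime] (π : V)
    [CharP (ResPi π) p] (n : ℕ) : SMul (PolyS V n) (Ω[SBar π n⁄ResPiPow p π]) :=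
  instSMulKaehlerDifferentialOfSMulCommClass (ResPiPow p π) (SBar π n)

instance instIsScalarTowerOmegaSBar {V : Type*} [CommRing V] (p : ℕ) [Fact p.Prime] (π : V)
    [CharP (ResPi π) p] (n : ℕ) :
    IsScalarTower (PolyS V n) (SBar π n) (Ω[SBar π n⁄ResPiPow p π]) :=
  KaehlerDifferential.isScalarTower_of_tower (ResPiPow p π) (SBar π n)

/-- The `S̄`-module `Ω^π = Ω_{S̄/k^p} ⊕ S̄ dπ`; the basis element `dπ` is `(0, 1)`. -/
abbrev OmegaPi {V : Type*} [CommRing V] (p : ℕ) [Fact p.Prime] (π : V) [CharP (ResPi π) p]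
    (n : ℕ) : Type _ :=
  Ω[SBar π n⁄ResPiPow p π] × SBar π n

/-- For an `R`-algebra `B`, a `K`-algebra structure on `B` and a derivation `∂ : R → B`, the
derivation `R → Ω_{B/K} ⊕ B`, `r ↦ (d_{B/K}(r̄), ∂ r)`, where `r̄` is the image of `r` in `B`. -/
def pairDer (K : Type*) {R B : Type*} [CommRing K] [CommRing R] [CommRing B] [Algebra K B]
    [Algebra R B] [SMulCommClass K R B] (δ : Derivation ℤ R B) :
    Derivation ℤ R (Ω[B⁄K] × B) :=
  Derivation.mk'
    (AddMonoidHom.toIntLinearMap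
      { toFun := fun r => (KaehlerDifferential.D K B (algebraMap R B r), δ r)
        map_zero' := by simp
        map_add' := fun a b => by simp })
    (fun a b => by
      ext
      · simp
      · simp)

/-- The derivation `d^π : S → Ω_{S̄/k^p} ⊕ S̄ dπ`, `s ↦ d_{S̄/k^p}(s̄) + ∂(s) dπ`, attached to a
derivation `∂ : S → S̄`. -/
def dPi {V : Type*} [CommRing V] (p : ℕ) [Fact p.Prime] (π : V) [CharP (ResPi π) p] (n : ℕ)
    (partialPi : Derivation ℤ (PolyS V n) (SBar π n)) :
    Derivation ℤ (PolyS V n) (OmegaPi p π n) :=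
  pairDer (ResPiPow p π) partialPi

/-- Post-composition with a derivation `d : R → N` into a `B`-module `N`, where `B` is an
`R`-algebra: the `B`-linear map `Hom_B(N, M) → Der_ℤ(R, M)`, `φ ↦ φ ∘ d`. It is natural in the
`B`-module `M`. -/
def postcompDer {R B N : Type*} [CommRing R] [CommRing B] [Algebra R B]
    [AddCommGroup N] [Module R N] [Module B N] [IsScalarTower R B N] (d : Derivation ℤ R N)
    (M : Type*) [AddCommGroup M] [Module R M] [Module B M] [IsScalarTower R B M] :
    (N →ₗ[B] M) →ₗ[B] Derivation ℤ R M where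
  toFun φ := (φ.restrictScalars R).compDer d
  map_add' _ _ := rfl
  map_smul' _ _ := rfl

/-- The derivation `d : R → N` into a `B`-module `N` represents the functor
`Der_ℤ(R, -) : B-Mod → B-Mod`: for every `B`-module `M` (regarded as an `R`-module through
`R → B`) the natural `B`-linear map `Hom_B(N, M) → Der_ℤ(R, M)`, `φ ↦ φ ∘ d`, is bijective. -/
def RepresentsDer.{v, u₁, u₂, u₃} {R : Type u₁} (B : Type u₂) {N : Type u₃} [CommRing R]
    [CommRing B] [Algebra R B] [AddCommGroup N] [Module R N] [Module B N] [IsScalarTower R B N]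
    (d : Derivation ℤ R N) : Prop :=
  ∀ (M : Type v) [AddCommGroup M] [Module R M] [Module B M] [IsScalarTower R B M],
    Function.Bijective (postcompDer (B := B) d M)

/-- The `S̄`-module `Ω̄_{S/ℤ} = Ω_{S/ℤ} / π Ω_{S/ℤ}`. -/
abbrev OmegaIntBar {V : Type*} [CommRing V] (π : V) (n : ℕ) : Type _ :=
  Ω[PolyS V n⁄ℤ] ⧸ (idealPi π n • ⊤ : Submodule (PolyS V n) (Ω[PolyS V n⁄ℤ]))

/-- The derivation `d̄_{S/ℤ} : S → Ω_{S/ℤ} → Ω_{S/ℤ} / π Ω_{S/ℤ}`. -/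
def dIntBar {V : Type*} [CommRing V] (π : V) (n : ℕ) :
    Derivation ℤ (PolyS V n) (OmegaIntBar π n) :=
  (Submodule.mkQ (idealPi π n • ⊤ : Submodule (PolyS V n) (Ω[PolyS V n⁄ℤ]))).compDer
    (KaehlerDifferential.D ℤ (PolyS V n))

end

/-! Ramification enters once: as `p ∈ π²V`, the ring `V/π²V` has characteristic `p`. Zorn's lemma
then gives a section `τ` of `V/π²V → k`, even for imperfect `k`. Each `v` is congruent to `τ(v̄) + π
τ(δ v)` modulo `π²` for a unique `δ v ∈ k`; this `δ` is a derivation with `δ π = 1`, and it extends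
to `S` by dual numbers. For representability, take a derivation `D : S → M` with `M` an `S̄`-module.
Then `D - ∂(·) D(π)` kills `π`, hence `πS`, so it descends to `S̄`. There it kills `p`-th powers, is
therefore `k^p`-linear, and factors through `Ω_{S̄/k^p}`; the value `D(π)` accounts for the summand
`S̄ dπ`. Part (3) is uniqueness of representing objects. -/

/-- Let `f : W → k` be a surjection from a ring of characteristic `p` onto a field such that every
element of the kernel has zero `p`-th power. Then `f` has a ring-theoretic section. -/
theorem exists_ringHom_section_of_frobenius_ker (p : ℕ) [Fact p.Prime] {W k : Type*} [CommRing W]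
    [CommRing k] [CharP W p] (hk : IsField k) (f : W →+* k) (hf : Function.Surjective f)
    (hker : ∀ w, f w = 0 → w ^ p = 0) : ∃ g : k →+* W, ∀ c, f (g c) = c := by
  have hp : p.Prime := Fact.out
  have : IsDomain k := hk.isDomain
  -- A maximal subring that contains all `p`-th powers and meets `ker f` trivially will be the image
  -- of the section.
  let s : Set (Subring W) := {A | (frobenius W p).range ≤ A ∧ ∀ a ∈ A, f a = 0 → a = 0}
  have hs0 : (frobenius W p).range ∈ s := by
    refine ⟨le_rfl, ?_⟩
    rintro _ ⟨w, rfl⟩ h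
    rw [frobenius_def, map_pow] at h
    exact hker w (eq_zero_of_pow_eq_zero h)
  obtain ⟨A, -, hA⟩ := zorn_le_nonempty₀ s (fun c hcs hc A₀ hA₀ => by
    have hdir : DirectedOn (· ≤ ·) c := hc.directedOn
    refine ⟨sSup c, ⟨(hcs hA₀).1.trans (le_sSup hA₀), fun a ha h => ?_⟩, fun B hB => le_sSup hB⟩
    obtain ⟨B, hB, haB⟩ := (Subring.mem_sSup_of_directedOn ⟨A₀, hA₀⟩ hdir).1 ha
    exact (hcs hB).2 a haB h) _ hs0
  obtain ⟨hpow, hinj⟩ := hA.prop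
  have hpow' : ∀ w : W, w ^ p ∈ A := fun w => hpow ⟨w, rfl⟩
  let φ : A →+* k := f.comp A.subtype
  have hφ : Function.Injective φ := by
    rw [injective_iff_map_eq_zero]
    exact fun a ha => Subtype.ext (hinj a a.2 ha)
  have hfieldA : IsField A := by
    refine ⟨⟨0, 1, fun h => ?_⟩, mul_comm, fun {a} ha => ?_⟩
    · exact zero_ne_one (by simpa using congrArg φ h : (0 : k) = 1)
    · have hfa : f a ≠ 0 := fun h => ha (Subtype.ext (hinj a a.2 h))
      obtain ⟨c, hc⟩ := hk.mul_inv_cancel hfa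
      obtain ⟨w, rfl⟩ := hf c
      -- If `f (a w) = 1`, then `(a w - 1)^p = 0`, so `a^p w^p = 1`, and `w^p` lies in `A` although
      -- `w` may not.
      refine ⟨a ^ (p - 1) * ⟨w ^ p, hpow' w⟩, ?_⟩
      have h1 : (a * w - 1 : W) ^ p = 0 := hker _ (by simp [hc])
      rw [sub_pow_char, one_pow, sub_eq_zero, mul_pow] at h1
      apply Subtype.ext
      simpa [← mul_assoc, ← pow_succ', Nat.sub_add_cancel hp.one_le] using h1
  have hsurj : Function.Surjective φ := by
    intro c
    by_contra! hc
    obtain ⟨w, rfl⟩ := hf c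
    let : Field A := hfieldA.toField
    let a : A := ⟨w ^ p, hpow' w⟩
    -- A `p`-th root `b` of `a` in `A` would satisfy `φ b = f w` by injectivity of Frobenius on `k`.
    have hirr : Irreducible (Polynomial.X ^ p - Polynomial.C a : Polynomial A) := by
      refine X_pow_sub_C_irreducible_of_prime hp fun b hb => hc b ?_
      have : CharP k p := charP_of_injective_ringHom (f := φ) hφ p
      have : φ b ^ p = f w ^ p := by
        rw [← map_pow, hb]; exact map_pow f w p
      exact frobenius_inj k p this
    let ev : Polynomial A →+* W := Polynomial.eval₂RingHom A.subtype w
    have hev : ev (Polynomial.X ^ p - Polynomial.C a) = 0 := by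
      simp [ev, a]
    have hmem : ev.range ∈ s := by
      refine ⟨hpow.trans fun b hb => ⟨Polynomial.C ⟨b, hb⟩, by simp [ev]⟩, ?_⟩
      rintro _ ⟨q, rfl⟩ hq
      -- By irreducibility, `q` is either a multiple of `X^p - a`, which vanishes at `w`, or coprime
      -- to it; a Bézout relation would then give `0 = 1` in `k`.
      by_cases hd : (Polynomial.X ^ p - Polynomial.C a : Polynomial A) ∣ q
      · obtain ⟨r, rfl⟩ := hd
        rw [map_mul, hev, zero_mul]
      · obtain ⟨u, v, huv⟩ := (hirr.coprime_iff_not_dvd).2 hd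
        have := congrArg (fun q => f (ev q)) huv
        simp [hev, hq] at this
    have hle : A ≤ ev.range := fun b hb => ⟨Polynomial.C ⟨b, hb⟩, by simp [ev]⟩
    have hw : w ∈ A := hA.le_of_ge hmem hle ⟨Polynomial.X, by simp [ev]⟩
    exact hc ⟨w, hw⟩ rfl
  let e : A ≃+* k := RingEquiv.ofBijective φ ⟨hφ, hsurj⟩
  exact ⟨A.subtype.comp e.symm, fun c => e.apply_symm_apply c⟩

/-- If `p ∈ π ^ 2 V` for a non-zero-divisor `π` with `V / π V` a field of characteristic `p`, then
there is a derivation `V → V / π V` sending `π` to `1`. -/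
theorem exists_derivation_resPi (p : ℕ) [Fact p.Prime] {V : Type*} [CommRing V] [IsDomain V]
    (π : V) (hπ : π ≠ 0) [CharP (ResPi π) p] (hk : IsField (ResPi π))
    (hram : (p : V) ∈ (Ideal.span {π} : Ideal V) ^ 2) :
    ∃ δ : Derivation ℤ V (ResPi π), δ π = 1 := by
  let I : Ideal V := Ideal.span {π}
  have hI : I ^ 2 ≤ I := Ideal.pow_le_self two_ne_zero
  let f : V ⧸ I ^ 2 →+* ResPi π := Ideal.Quotient.factor hI
  let q : V →+* V ⧸ I ^ 2 := Ideal.Quotient.mk _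
  have hfq : ∀ v, f (q v) = Ideal.Quotient.mk _ v := fun v => rfl
  -- Multiplication by `π` identifies `V/πV` with `πV/π²V`.
  have hq0 : ∀ v, q (π * v) = 0 ↔ (Ideal.Quotient.mk I v) = 0 := fun v => by
    rw [Ideal.Quotient.eq_zero_iff_mem, Ideal.Quotient.eq_zero_iff_mem, Ideal.span_singleton_pow,
      Ideal.mem_span_singleton, Ideal.mem_span_singleton, pow_two, mul_dvd_mul_iff_left hπ]
  have hker : ∀ w, f w = 0 → ∃ v, w = q (π * v) := fun w hw => by
    obtain ⟨v, rfl⟩ := Ideal.Quotient.mk_surjective w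
    obtain ⟨v, rfl⟩ := Ideal.mem_span_singleton.1 (Ideal.Quotient.eq_zero_iff_mem.1 hw)
    exact ⟨v, rfl⟩
  have hchar : CharP (V ⧸ I ^ 2) p := by
    have hp0 : ((p : ℕ) : V ⧸ I ^ 2) = 0 := by
      rw [← map_natCast q]; exact Ideal.Quotient.eq_zero_iff_mem.2 hram
    refine ⟨fun n => ⟨fun h => (CharP.cast_eq_zero_iff (ResPi π) p n).1 ?_, ?_⟩⟩
    · rw [← map_natCast f, h, map_zero]
    · rintro ⟨m, rfl⟩
      rw [Nat.cast_mul, hp0, zero_mul]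
  obtain ⟨τ, hτ⟩ := exists_ringHom_section_of_frobenius_ker p hk f
    (Ideal.Quotient.factor_surjective hI)
    (fun w hw => by
      obtain ⟨v, rfl⟩ := hker w hw
      obtain ⟨r, hr⟩ := Nat.exists_eq_add_of_le (Fact.out : p.Prime).two_le
      rw [hr, pow_add, ← map_pow, mul_pow, pow_two π, mul_assoc, (hq0 _).2, zero_mul]
      rw [map_mul, Ideal.Quotient.eq_zero_iff_mem.2 (Ideal.mem_span_singleton_self π), zero_mul])
  have hmul : ∀ w, f w = 0 → q π * w = 0 := fun w hw => by
    obtain ⟨v, rfl⟩ := hker w hw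
    rw [← map_mul, hq0, map_mul,
      Ideal.Quotient.eq_zero_iff_mem.2 (Ideal.mem_span_singleton_self π), zero_mul]
  have huniq : ∀ b c : ResPi π, q π * τ b = q π * τ c → b = c := fun b c h => by
    rw [← sub_eq_zero, ← mul_sub, ← map_sub] at h
    obtain ⟨v, hv⟩ := Ideal.Quotient.mk_surjective (τ (b - c))
    have h1 : Ideal.Quotient.mk I v = 0 := (hq0 v).1 (by rw [map_mul]; exact hv ▸ h)
    have h2 : f (τ (b - c)) = 0 := by rw [← hv]; exact h1
    exact sub_eq_zero.1 (by rwa [hτ] at h2)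
  have hex : ∀ v, ∃ b : ResPi π, q v = τ (Ideal.Quotient.mk _ v) + q π * τ b := fun v => by
    obtain ⟨u, hu⟩ := hker (q v - τ (Ideal.Quotient.mk _ v)) (by rw [map_sub, hτ, hfq, sub_self])
    refine ⟨Ideal.Quotient.mk _ u, ?_⟩
    -- The coefficient `u` of `π` matters only modulo `π`, so it may be replaced by `τ(ū)`.
    have := hmul (q u - τ (Ideal.Quotient.mk _ u)) (by rw [map_sub, hτ, hfq, sub_self])
    rw [mul_sub, ← map_mul, ← hu] at this
    linear_combination this
  choose δ hδ using hex
  refine ⟨Derivation.mk' (AddMonoidHom.toIntLinearMap (AddMonoidHom.mk' δ fun a b => ?_))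
    fun a b => ?_, ?_⟩
  · apply huniq
    have h := hδ (a + b)
    simp only [map_add] at h ⊢
    linear_combination hδ a + hδ b - h
  · apply huniq
    change q π * τ (δ (a * b)) =
      q π * τ (Ideal.Quotient.mk _ a * δ b + Ideal.Quotient.mk _ b * δ a)
    have h := hδ (a * b)
    have hπ2 := hmul (q π) (Ideal.Quotient.eq_zero_iff_mem.2 (Ideal.mem_span_singleton_self π))
    simp only [map_mul, map_add] at h ⊢
    linear_combination q b * hδ a + (τ (Ideal.Quotient.mk _ a) + q π * τ (δ a)) * hδ b - h +
      τ (δ a) * τ (δ b) * hπ2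
  · apply huniq
    have h := hδ π
    have h0 : (Ideal.Quotient.mk (Ideal.span {π}) π) = 0 :=
      Ideal.Quotient.eq_zero_iff_mem.2 (Ideal.mem_span_singleton_self π)
    rw [h0, map_zero, zero_add] at h
    change q π * τ (δ π) = _
    rw [← h, map_one, mul_one]

/-- A derivation of `V` into an `A`-module, where `A` is an algebra over `V[x_i]`, extends to a
derivation of `V[x_i]` vanishing on the variables. -/
theorem MvPolynomial.exists_derivation_extension {σ V A : Type*} [CommRing V] [CommRing A]
    [Algebra (MvPolynomial σ V) A] (δ : V → A) (hadd : ∀ a b, δ (a + b) = δ a + δ b)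
    (hmul : ∀ a b, δ (a * b) = algebraMap (MvPolynomial σ V) A (C a) * δ b +
      algebraMap (MvPolynomial σ V) A (C b) * δ a) :
    ∃ D : Derivation ℤ (MvPolynomial σ V) A, (∀ v, D (C v) = δ v) ∧ ∀ i, D (X i) = 0 := by
  let ι : V →+* A := (algebraMap (MvPolynomial σ V) A).comp C
  have h1 : δ 1 = 0 := by simpa using hmul 1 1
  -- The Leibniz rule for `δ` says that `v ↦ v + δ(v) ε` is multiplicative into the dual numbers
  -- `A[ε]`.
  let g : V →+* TrivSqZeroExt A A := RingHom.mk' (⟨⟨fun v => .inl (ι v) + .inr (δ v),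
    by simp [h1]⟩, fun a b => by
      ext
      · simp
      · simpa [ι, mul_comm (δ a)] using hmul a b⟩) fun a b => by
      ext <;> simp [hadd]
  have hg₁ : ∀ v, (g v).fst = ι v := fun v => by
    change (TrivSqZeroExt.inl (ι v) + TrivSqZeroExt.inr (δ v) : TrivSqZeroExt A A).fst = ι v
    rw [TrivSqZeroExt.fst_add, TrivSqZeroExt.fst_inl, TrivSqZeroExt.fst_inr, add_zero]
  have hg₂ : ∀ v, (g v).snd = δ v := fun v => by
    change (TrivSqZeroExt.inl (ι v) + TrivSqZeroExt.inr (δ v) : TrivSqZeroExt A A).snd = δ v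
    rw [TrivSqZeroExt.snd_add, TrivSqZeroExt.snd_inl, TrivSqZeroExt.snd_inr, zero_add]
  let G : MvPolynomial σ V →+* TrivSqZeroExt A A :=
    eval₂Hom g fun i => .inl (algebraMap (MvPolynomial σ V) A (X i))
  have hfst : ∀ s, (G s).fst = algebraMap (MvPolynomial σ V) A s := by
    have : (TrivSqZeroExt.fstHom A A A).toRingHom.comp G =
        algebraMap (MvPolynomial σ V) A := by
      apply MvPolynomial.ringHom_ext
      · intro v; simp [G, hg₁, ι]
      · intro i; simp [G]
    exact fun s => RingHom.congr_fun this s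
  refine ⟨Derivation.mk' (AddMonoidHom.toIntLinearMap
    (AddMonoidHom.mk' (fun s => (G s).snd) fun a b => ?_)) fun a b => ?_, fun v => ?_, fun i => ?_⟩
  · simp
  · simp [hfst, Algebra.smul_def, mul_comm]
  · simp [G, hg₂]
  · simp [G]

/-- A derivation `V → V / π V` sending `π` to `1` extends to `V[x_1, …, x_n]`. -/
theorem exists_derivation_sBar (p : ℕ) [Fact p.Prime] {V : Type*} [CommRing V] [IsDomain V]
    (π : V) (hπ : π ≠ 0) [CharP (ResPi π) p] (hk : IsField (ResPi π))
    (hram : (p : V) ∈ (Ideal.span {π} : Ideal V) ^ 2) (n : ℕ) :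
    ∃ D : Derivation ℤ (PolyS V n) (SBar π n),
      D (MvPolynomial.C π) = 1 ∧ ∀ i : Fin n, D (MvPolynomial.X i) = 0 := by
  obtain ⟨δ, hδ⟩ := exists_derivation_resPi p π hπ hk hram
  obtain ⟨D, hC, hX⟩ := MvPolynomial.exists_derivation_extension (σ := Fin n) (A := SBar π n)
    (fun v => resPiToSBar π n (δ v)) (fun a b => by simp) (fun a b => by
      rw [Derivation.leibniz, map_add]
      exact congrArg₂ (· + ·) (map_mul (resPiToSBar π n) (Ideal.Quotient.mk _ a) (δ b))
        (map_mul (resPiToSBar π n) (Ideal.Quotient.mk _ b) (δ a)))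
  exact ⟨D, by rw [hC, hδ, map_one], hX⟩

/-! ### Factoring derivations and representability -/

/-- A derivation from a ring `B` vanishing on the image of `K` is `K`-linear, so it factors through
`Ω_{B/K}`. -/
theorem KaehlerDifferential.exists_lift_of_map_algebraMap {K B M : Type*} [CommRing K] [CommRing B]
    [Algebra K B] [AddCommGroup M] [Module B M] (D : Derivation ℤ B M)
    (hD : ∀ c, D (algebraMap K B c) = 0) :
    ∃ ψ : Ω[B⁄K] →ₗ[B] M, ∀ b, ψ (KaehlerDifferential.D K B b) = D b := by
  let _ : Module K M := Module.compHom M (algebraMap K B)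
  have hsmul : ∀ (c : K) (m : M), c • m = algebraMap K B c • m := fun c m => rfl
  have : IsScalarTower K B M := .of_algebraMap_smul fun c m => rfl
  let D' : Derivation K B M := Derivation.mk'
    { toFun := D
      map_add' := map_add D
      map_smul' := fun c b => by
        rw [Algebra.smul_def, D.leibniz, hD, smul_zero, add_zero, RingHom.id_apply, hsmul] }
    D.leibniz
  exact ⟨D'.liftKaehlerDifferential, D'.liftKaehlerDifferential_comp_D⟩

/-- A derivation of `R` vanishing on the kernel of a surjection `R → B` descends to `B`. -/
theorem Derivation.exists_descend {R B M : Type*} [CommRing R] [CommRing B] [Algebra R B]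
    [AddCommGroup M] [Module R M] [Module B M] [IsScalarTower R B M]
    (hsurj : Function.Surjective (algebraMap R B)) (D : Derivation ℤ R M)
    (hD : ∀ r, algebraMap R B r = 0 → D r = 0) :
    ∃ D' : Derivation ℤ B M, ∀ r, D' (algebraMap R B r) = D r := by
  have hwd : ∀ r s, algebraMap R B r = algebraMap R B s → D r = D s := fun r s h => by
    rw [← sub_eq_zero, ← map_sub]
    exact hD _ (by rw [map_sub, h, sub_self])
  choose σ hσ using hsurj
  refine ⟨Derivation.mk' (AddMonoidHom.toIntLinearMap
    (AddMonoidHom.mk' (fun b => D (σ b)) fun a b => ?_)) fun a b => ?_, fun r => ?_⟩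
  · rw [← map_add]
    exact hwd _ _ (by simp [hσ])
  · change D (σ (a * b)) = a • D (σ b) + b • D (σ a)
    conv_rhs => rw [← hσ a, ← hσ b, algebraMap_smul, algebraMap_smul, hσ, hσ]
    rw [← D.leibniz]
    exact hwd _ _ (by simp [hσ])
  · exact hwd _ _ (hσ _)

/-- Let `B = R / ϖ R` and let `∂ : R → B` be a derivation with `∂ ϖ = 1`. If every derivation of `B`
kills the image of `K`, then `R → Ω_{B/K} ⊕ B`, `r ↦ (d r̄, ∂ r)`, represents `Der_ℤ(R, -)` on
`B`-modules. -/
theorem pairDer_representsDer.{v} {K R B : Type*} [CommRing K] [CommRing R] [CommRing B]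
    [Algebra K B] [Algebra R B] [SMulCommClass K R B] (δ : Derivation ℤ R B) (ϖ : R)
    (hsurj : Function.Surjective (algebraMap R B))
    (hker : ∀ r, algebraMap R B r = 0 ↔ ϖ ∣ r) (hδ : δ ϖ = 1)
    (hK : ∀ (M : Type v) [AddCommGroup M] [Module B M] (D : Derivation ℤ B M) (c : K),
      D (algebraMap K B c) = 0) :
    RepresentsDer.{v} B (pairDer K δ) := by
  have hϖ : algebraMap R B ϖ = 0 := (hker ϖ).2 dvd_rfl
  intro M _ _ _ _
  have happ : ∀ (φ : (Ω[B⁄K] × B) →ₗ[B] M) r, postcompDer (pairDer K δ) M φ r =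
      φ (KaehlerDifferential.D K B (algebraMap R B r), δ r) := fun φ r => rfl
  constructor
  · intro φ φ' h
    have h' : ∀ r, φ (KaehlerDifferential.D K B (algebraMap R B r), δ r) =
      φ' (KaehlerDifferential.D K B (algebraMap R B r), δ r) := fun r => by
        rw [← happ, ← happ, h]
    -- Since `ϖ` maps to `0` in `B` and `δ ϖ = 1`, the pair attached to `ϖ` is `(0, 1)`.
    have h1 : φ (0, 1) = φ' (0, 1) := by simpa [hϖ, hδ] using h' ϖ
    have h2 : ∀ b : B, φ (0, b) = φ' (0, b) := fun b => by
      have : ((0, b) : Ω[B⁄K] × B) = b • (0, 1) := by simp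
      rw [this, map_smul, map_smul, h1]
    apply LinearMap.prod_ext
    · let _ : Module K M := Module.compHom M (algebraMap K B)
      have : IsScalarTower K B M := .of_algebraMap_smul fun c m => rfl
      apply Derivation.liftKaehlerDifferential_unique
      ext b
      obtain ⟨r, rfl⟩ := hsurj b
      have h3 := h' r
      have : ((KaehlerDifferential.D K B (algebraMap R B r), δ r) : Ω[B⁄K] × B) =
        (KaehlerDifferential.D K B (algebraMap R B r), 0) + (0, δ r) := by simp
      rw [this, map_add, map_add, h2, add_left_inj] at h3
      exact h3
    · ext
      exact h1
  · intro D
    let m := D ϖ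
    let D₁ : Derivation ℤ R M := D - ((LinearMap.toSpanSingleton B M m).restrictScalars R).compDer δ
    have hD₁ : ∀ r, D₁ r = D r - δ r • m := fun r => rfl
    obtain ⟨D₂, hD₂⟩ := D₁.exists_descend hsurj fun r hr => by
      obtain ⟨s, rfl⟩ := (hker r).1 hr
      rw [D₁.leibniz, hD₁ ϖ, hδ, one_smul, sub_self, smul_zero, add_zero,
        ← algebraMap_smul B ϖ (D₁ s), hϖ, zero_smul]
    obtain ⟨ψ, hψ⟩ := KaehlerDifferential.exists_lift_of_map_algebraMap (K := K) D₂ (hK M D₂)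
    refine ⟨ψ.coprod (LinearMap.toSpanSingleton B M m), ?_⟩
    ext r
    rw [happ, LinearMap.coprod_apply, hψ, hD₂, hD₁, LinearMap.toSpanSingleton_apply, sub_add_cancel]

/-- The derivation `R → Ω_{R/ℤ} / I Ω_{R/ℤ}` is isomorphic to every derivation `d` into an
`R / I`-module which represents `Der_ℤ(R, -)` on `R / I`-modules. -/
theorem exists_linearEquiv_of_representsDer.{u₁, u₂} {R : Type u₁} [CommRing R] (I : Ideal R)
    {N : Type u₂} [AddCommGroup N] [Module R N] [Module (R ⧸ I) N] [IsScalarTower R (R ⧸ I) N]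
    (d : Derivation ℤ R N) (hN : RepresentsDer.{u₂} (R ⧸ I) d) (hQ : RepresentsDer.{u₁} (R ⧸ I) d) :
    ∃ e : (Ω[R⁄ℤ] ⧸ (I • ⊤ : Submodule R (Ω[R⁄ℤ]))) ≃ₗ[R ⧸ I] N,
      ∀ r, e (Submodule.Quotient.mk (KaehlerDifferential.D ℤ R r)) = d r := by
  let Q := Ω[R⁄ℤ] ⧸ (I • ⊤ : Submodule R (Ω[R⁄ℤ]))
  let dQ : Derivation ℤ R Q := (Submodule.mkQ (I • ⊤ : Submodule R (Ω[R⁄ℤ]))).compDer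
    (KaehlerDifferential.D ℤ R)
  -- `Q` and `N` may live in different universes, hence the two representability hypotheses.
  obtain ⟨ψ, hψ⟩ := (hQ Q).2 dQ
  have hψ' : ∀ r, ψ (d r) = dQ r := fun r => Derivation.congr_fun hψ r
  let φ₀ : Q →ₗ[R] N := Submodule.liftQ _ d.liftKaehlerDifferential (by
    rw [Submodule.smul_le]
    intro r hr x _
    rw [LinearMap.mem_ker, map_smul, ← algebraMap_smul (R ⧸ I) r,
      Ideal.Quotient.algebraMap_eq, Ideal.Quotient.eq_zero_iff_mem.2 hr, zero_smul])
  let φ : Q →ₗ[R ⧸ I] N := φ₀.extendScalarsOfSurjective Ideal.Quotient.mk_surjective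
  have hφ : ∀ r, φ (dQ r) = d r := fun r => d.liftKaehlerDifferential_comp_D r
  have h1 : φ.comp ψ = LinearMap.id := (hN N).1 (by
    ext r
    change φ (ψ (d r)) = d r
    rw [hψ', hφ])
  have h2 : (ψ.restrictScalars R).comp φ₀ = LinearMap.id := by
    apply Submodule.linearMap_qext
    apply Derivation.liftKaehlerDifferential_unique
    ext r
    change ψ (φ (dQ r)) = dQ r
    rw [hφ, hψ']
  exact ⟨.ofLinearMap φ ψ h1 (LinearMap.ext fun x => LinearMap.congr_fun h2 x), hφ⟩

/-! ### Application to `S = V[x_1, …, x_n]` -/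

/-- A derivation of `S / π S` kills the image of `k^p`. -/
theorem derivation_sBar_algebraMap_resPiPow (p : ℕ) [Fact p.Prime] {V : Type*} [CommRing V] (π : V)
    [CharP (ResPi π) p] (n : ℕ) {M : Type*} [AddCommGroup M] [Module (SBar π n) M]
    (D : Derivation ℤ (SBar π n) M) (c : ResPiPow p π) :
    D (algebraMap (ResPiPow p π) (SBar π n) c) = 0 := by
  obtain ⟨_, c, rfl⟩ := c
  have hp : ((p : ℕ) : SBar π n) = 0 := by
    rw [← map_natCast (resPiToSBar π n), CharP.cast_eq_zero, map_zero]
  change D (resPiToSBar π n (c ^ p)) = 0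
  rw [map_pow, D.leibniz_pow, ← Nat.cast_smul_eq_nsmul (SBar π n), hp]
  exact zero_smul (SBar π n) (_ : M)

/-- The derivation `d^π : S → Ω_{S̄/k^p} ⊕ S̄ dπ` represents `Der_ℤ(S, -)` on `S̄`-modules. -/
theorem dPi_representsDer.{v} (p : ℕ) [Fact p.Prime] {V : Type*} [CommRing V] (π : V)
    [CharP (ResPi π) p] (n : ℕ) (D : Derivation ℤ (PolyS V n) (SBar π n))
    (hD : D (MvPolynomial.C π) = 1) : RepresentsDer.{v} (SBar π n) (dPi p π n D) :=
  pairDer_representsDer D (MvPolynomial.C π) Ideal.Quotient.mk_surjective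
    (fun _ => Ideal.Quotient.eq_zero_iff_mem.trans Ideal.mem_span_singleton) hD
    fun _ _ _ => derivation_sBar_algebraMap_resPiPow p π n

theorem mainTheorem5 (p : ℕ) [Fact p.Prime]
    {V : Type u} [CommRing V] [IsDomain V] [IsDiscreteValuationRing V] [CharZero V]
    (π : V) (hπ : Irreducible π) [CharP (ResPi π) p]
    (hram : (p : V) ∈ (Ideal.span {π} : Ideal V) ^ 2) (n : ℕ) :
    (∃ partialPi : Derivation ℤ (PolyS V n) (SBar π n),
      partialPi (MvPolynomial.C π) = 1 ∧ ∀ i : Fin n, partialPi (MvPolynomial.X i) = 0) ∧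
    ∀ partialPi : Derivation ℤ (PolyS V n) (SBar π n), partialPi (MvPolynomial.C π) = 1 →
      RepresentsDer.{w} (SBar π n) (dPi p π n partialPi) ∧
      ∃ e : OmegaIntBar π n ≃ₗ[SBar π n] OmegaPi p π n,
        ∀ s : PolyS V n, e (dIntBar π n s) = dPi p π n partialPi s := by
  have hmax : (Ideal.span {π} : Ideal V).IsMaximal := PrincipalIdealRing.isMaximal_of_irreducible hπ
  have hk : IsField (ResPi π) := (Ideal.Quotient.maximal_ideal_iff_isField_quotient _).1 hmax
  refine ⟨exists_derivation_sBar p π hπ.ne_zero hk hram n, fun D hD => ?_⟩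
  exact ⟨dPi_representsDer p π n D hD, exists_linearEquiv_of_representsDer (idealPi π n)
    (dPi p π n D) (dPi_representsDer p π n D hD) (dPi_representsDer p π n D hD)⟩
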